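/- Let $k$ be a field and let $\mathcal C$ be a finite direct category, i.e. a category with finitely many objects and morphisms that contains no infinite chain (ascending or descending) of composable non-identity morphisms; in particular it has no cycles of positive length. A morphism of $\mathcal C$ is irreducible if it is not an identity and in every factorization $\varphi=\alpha\circ\beta$ one of $\alpha,\beta$ is an identity. The composition length of $\mathcal C$ is the length of a longest chain of composable irreducible morphisms in $\mathcal C$; assume that it is a positive integer $N$. For $n\ge 0$ let $\mathcal E_n^{\mathcal C}$ be the full subcategory of the functor category $\mathcal C^{[n]}$ on the non-degenerate $n$-simplices $x_0\to\cdots\to x_n$ of the nerve $|\mathcal C|$. Let $\mathcal G_n^{\mathcal C}\subseteq\mathcal E_n^{\mathcal C}$ be the subcategory with the same objects, whose morphisms are the identities and the natural transformations $\underline x\to\underline y$ with components $x_i\to x_n\xrightarrow{w}y_0\to y_i$ for some morphism $w\colon x_n\to y_0$ of $\mathcal C$. Let $\mathcal G_n^{\mathcal C,\emptyset}\subseteq\mathcal G_n^{\mathcal C}$ be the discrete subcategory with the same objects. With the face operators of the nerve these form semi-simplicial objects $\mathcal E_\bullet^{\mathcal C}$, $\mathcal G_\bullet^{\mathcal C}$,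 $\mathcal G_\bullet^{\mathcal C,\emptyset}$ in the category of small categories. For a small category $\mathcal D$, let $\mathrm{Gr}(k\mathcal D)$ be the (split) Grothendieck group of isomorphism classes of functors from $\mathcal D$ to finite-dimensional $k$-vector spaces, with addition induced by direct sum. For a semi-simplicial object $\mathcal D_\bullet$ in small categories, let $\mathscr R^n(\mathcal D_\bullet,k)$ be the $n$-th cohomology of the cochain complex $\mathrm{Gr}(k\mathcal D_\bullet)$, whose differential is the alternating sum of the maps $\delta^i[M]=[M\circ\partial_i]$. Put $\mathscr E^n(\mathcal C,k)=\mathscr R^n(\mathcal E_\bullet^{\mathcal C},k)$ and $\mathscr G^n(\mathcal C,k)=\mathscr R^n(\mathcal G_\bullet^{\mathcal C},k)$. Then $\mathscr E^n(\mathcal C,k)=\mathscr G^n(\mathcal C,k)=0$ for all $n>N$. Furthermore, there are isomorphisms $\mathscr R^n(\mathcal G_\bullet^{\mathcal C,\emptyset},k)\cong H^n(|\mathcal C|,\mathbb Z)$ for all $n\ge 0$, under which the class of a cocycle $z$ corresponds to the class of an integral cocycle $c$ on $|\mathcal C|$ whenever the dimension function of $z$ agrees with $c$ on the non-degenerate $n$-simplices;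 and the composite $$\mathscr G^n(\mathcal C,k)\xrightarrow{\ \iota^*\ }\mathscr R^n(\mathcal G_\bullet^{\mathcal C,\emptyset},k)\cong H^n(|\mathcal C|,\mathbb Z),$$ where $\iota^*$ is induced by the inclusion $\iota\colon\mathcal G_\bullet^{\mathcal C,\emptyset}\subseteq\mathcal G_\bullet^{\mathcal C}$, is an isomorphism for all $n\ge\lfloor N/2\rfloor+1$ and an epimorphism for $1\le n\le\lfloor N/2\rfloor$. -/

import Mathlib

open CategoryTheory CategoryTheory.Limits

universe w v v' v'' u u' u''

noncomputable section

namespace RepCoh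

/-! ### Semi-cosimplicial abelian groups and their cohomology -/

/-- A semi-cosimplicial abelian group: abelian groups `A⁰, A¹, …` with coface homomorphisms
`δ⁰, …, δⁿ⁺¹ : Aⁿ → Aⁿ⁺¹` satisfying the cosimplicial identities. -/
structure SemiCosimplicialAb where
  obj : ℕ → Type u
  [grp : ∀ n, AddCommGroup (obj n)]
  coface : ∀ n, Fin (n + 2) → (obj n →+ obj (n + 1))
  coface_coface : ∀ (n : ℕ) (i j : Fin (n + 2)), i ≤ j → ∀ a : obj n,
    coface (n + 1) j.succ (coface n i a) = coface (n + 1) i.castSucc (coface n j a)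

attribute [instance] SemiCosimplicialAb.grp

namespace SemiCosimplicialAb

variable (A : SemiCosimplicialAb.{u}) (B : SemiCosimplicialAb.{u'})

/-- The coboundary operator: the alternating sum of the cofaces. -/
def d (n : ℕ) : A.obj n →+ A.obj (n + 1) :=
  ∑ i : Fin (n + 2), (-1 : ℤ) ^ (i : ℕ) • A.coface n i

theorem d_apply (n : ℕ) (a : A.obj n) :
    A.d n a = ∑ i : Fin (n + 2), (-1 : ℤ) ^ (i : ℕ) • A.coface n i a := by
  simp [d, AddMonoidHom.finsetSum_apply]

theorem d_d (n : ℕ) (a : A.obj n) : A.d (n + 1) (A.d n a) = 0 := by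
  simp only [d_apply, map_sum, map_zsmul, Finset.smul_sum, smul_smul, ← Finset.sum_product']
  let P := Fin (n + 2) × Fin (n + 3)
  let S : Finset P := {ij : P | (ij.2 : ℕ) ≤ (ij.1 : ℕ)}
  rw [Finset.univ_product_univ, ← Finset.sum_add_sum_compl S, ← eq_neg_iff_add_eq_zero,
    ← Finset.sum_neg_distrib]
  let φ : ∀ ij : P, ij ∈ S → P := fun ij hij =>
    (Fin.castLT ij.2 (lt_of_le_of_lt (Finset.mem_filter.mp hij).right (Fin.is_lt ij.1)), ij.1.succ)
  apply Finset.sum_bij φ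
  · intro ij hij
    simp_rw [S, φ, Finset.compl_filter, Finset.mem_filter_univ, Fin.val_succ,
      Fin.val_castLT] at hij ⊢
    lia
  · rintro ⟨i, j⟩ hij ⟨i', j'⟩ hij' h
    rw [Prod.mk_inj]
    exact ⟨by simpa [φ] using! congr_arg Prod.snd h,
      by simpa [φ, Fin.castSucc_castLT] using! congr_arg Fin.castSucc (congr_arg Prod.fst h)⟩
  · rintro ⟨i', j'⟩ hij'
    simp_rw [S, Finset.compl_filter, Finset.mem_filter_univ, not_le] at hij'
    refine ⟨(j'.pred <| ?_, Fin.castSucc i'), ?_, ?_⟩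
    · rintro rfl
      simp only [Fin.val_zero, not_lt_zero] at hij'
    · simpa [S] using! Nat.le_sub_one_of_lt hij'
    · simp only [φ, Fin.castLT_castSucc, Fin.succ_pred]
  · rintro ⟨i, j⟩ hij
    have hij' : (j : ℕ) ≤ i := by simpa [S] using hij
    have hj : (j : ℕ) < n + 2 := lt_of_le_of_lt hij' i.2
    have key := A.coface_coface n (j.castLT hj) i (by simpa [Fin.le_def] using hij') a
    rw [Fin.castSucc_castLT] at key
    simp only [φ, Fin.val_succ, Fin.val_castLT]
    rw [key, ← neg_smul]
    congr 1
    ring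

/-- The group of `n`-cocycles. -/
def cocycles (n : ℕ) : AddSubgroup (A.obj n) := (A.d n).ker

/-- The group of `n`-coboundaries (trivial for `n = 0`). -/
def coboundaries : ∀ n : ℕ, AddSubgroup (A.obj n)
  | 0 => ⊥
  | n + 1 => (A.d n).range

theorem coboundaries_le_cocycles (n : ℕ) : A.coboundaries n ≤ A.cocycles n := by
  cases n with
  | zero => exact bot_le
  | succ n => rintro _ ⟨a, rfl⟩; exact A.d_d n a

/-- The `n`-th cohomology group: cocycles modulo coboundaries. -/
abbrev H (n : ℕ) : Type u := A.cocycles n ⧸ (A.coboundaries n).addSubgroupOf (A.cocycles n)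

/-- The cohomology class of a cocycle. -/
abbrev cls {n : ℕ} (z : A.cocycles n) : A.H n := QuotientAddGroup.mk z

/-- Morphisms of semi-cosimplicial abelian groups. -/
structure Hom where
  app : ∀ n, A.obj n →+ B.obj n
  comm : ∀ (n : ℕ) (i : Fin (n + 2)) (a : A.obj n),
    app (n + 1) (A.coface n i a) = B.coface n i (app n a)

variable {A B}

theorem Hom.comm_d (f : Hom A B) (n : ℕ) (a : A.obj n) :
    f.app (n + 1) (A.d n a) = B.d n (f.app n a) := by
  simp [d_apply, f.comm]

/-- The map induced on cocycles. -/
def Hom.mapCocycles (f : Hom A B) (n : ℕ) : A.cocycles n →+ B.cocycles n :=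
  ((f.app n).comp (A.cocycles n).subtype).codRestrict _ fun z => by
    have hz : A.d n z = 0 := z.2
    change B.d n (f.app n z) = 0
    rw [← f.comm_d, hz, map_zero]

/-- The map induced on cohomology. -/
def Hom.mapH (f : Hom A B) (n : ℕ) : A.H n →+ B.H n :=
  QuotientAddGroup.map _ _ (f.mapCocycles n) <| by
    rintro ⟨z, hz⟩ h
    change f.app n z ∈ B.coboundaries n
    replace h : z ∈ A.coboundaries n := h
    cases n with
    | zero =>
      have h0 : z = 0 := h
      rw [h0, map_zero]; exact zero_mem _
    | succ n =>
      obtain ⟨a, rfl⟩ := h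
      exact ⟨f.app n a, (f.comm_d n a).symm⟩

end SemiCosimplicialAb

/-- The integral cochains of a simplicial set `X`: the functions `Xₙ → ℤ`. -/
def cochains (X : SSet.{u}) : SemiCosimplicialAb.{u} where
  obj n := X.obj (Opposite.op (SimplexCategory.mk n)) → ℤ
  coface n i :=
    { toFun := fun f x => f (X.δ i x)
      map_zero' := rfl
      map_add' := fun _ _ => rfl }
  coface_coface n i j hij f := by
    funext x
    exact congrArg f (ConcreteCategory.congr_hom (X.δ_comp_δ hij) x)

/-- `Hⁿ(X, ℤ)` for a simplicial set `X`. -/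
abbrev integralCohomology (X : SSet.{u}) (n : ℕ) : Type u := (cochains X).H n

/-! ### Modules over a category and the (split) Grothendieck group -/

section Grothendieck

variable (k : Type w) [Field k]

/-- `kD`-modules: functors from `D` to finite-dimensional `k`-vector spaces. -/
abbrev Rep (D : Type u) [Category.{v} D] := D ⥤ FGModuleCat.{w} k

/-- The relations `[L] = [M] + [N]` whenever `L ≅ M ⊕ N`. (With `N = 0` this gives `[L] = [M]`
whenever `L ≅ M`.) -/
def grRel (D : Type u) [Category.{v} D] : AddSubgroup (FreeAbelianGroup (Rep k D)) :=
  AddSubgroup.closure {x | ∃ L M N : Rep k D, Nonempty (L ≅ M ⊞ N) ∧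
    x = FreeAbelianGroup.of L - (FreeAbelianGroup.of M + FreeAbelianGroup.of N)}

/-- The (split) Grothendieck group of isomorphism classes of `kD`-modules, with addition induced
by the direct sum. -/
abbrev Gr (D : Type u) [Category.{v} D] := FreeAbelianGroup (Rep k D) ⧸ grRel k D

variable {k}

/-- The class `[M]`. -/
def Gr.mk {D : Type u} [Category.{v} D] (M : Rep k D) : Gr k D :=
  QuotientAddGroup.mk (FreeAbelianGroup.of M)

variable (k)

/-- Pull-back of modules along a functor `F`: `[M] ↦ [M ∘ F]`. -/
def Gr.pull {D : Type u} [Category.{v} D] {D' : Type u'} [Category.{v'} D'] (F : D ⥤ D') :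
    Gr k D' →+ Gr k D :=
  QuotientAddGroup.map _ _ (FreeAbelianGroup.map fun M : Rep k D' => F ⋙ M) <| by
    rw [grRel, AddSubgroup.closure_le]
    rintro _ ⟨L, M, N, ⟨e⟩, rfl⟩
    refine AddSubgroup.subset_closure ⟨F ⋙ L, F ⋙ M, F ⋙ N, ⟨?_⟩, by simp⟩
    have := preservesBinaryBiproducts_of_preservesBiproducts
      ((Functor.whiskeringLeft D D' (FGModuleCat.{w} k)).obj F)
    exact ((Functor.whiskeringLeft D D' (FGModuleCat.{w} k)).obj F).mapIso e ≪≫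
      ((Functor.whiskeringLeft D D' (FGModuleCat.{w} k)).obj F).mapBiprod M N

@[simp]
theorem Gr.pull_mk {D : Type u} [Category.{v} D] {D' : Type u'} [Category.{v'} D'] (F : D ⥤ D')
    (M : Rep k D') : Gr.pull k F (Gr.mk M) = Gr.mk (F ⋙ M) := by
  simp [Gr.pull, Gr.mk]

variable {k} in
theorem Gr.hom_ext {D : Type u} [Category.{v} D] {A : Type*} [AddCommGroup A]
    {f g : Gr k D →+ A} (h : ∀ M, f (Gr.mk M) = g (Gr.mk M)) : f = g :=
  QuotientAddGroup.addMonoidHom_ext _ (FreeAbelianGroup.lift_ext _ _ h)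

theorem Gr.pull_pull {D : Type u} [Category.{v} D] {D' : Type u'} [Category.{v'} D']
    {D'' : Type u''} [Category.{v''} D''] (F : D ⥤ D') (F' : D' ⥤ D'') (a : Gr k D'') :
    Gr.pull k F (Gr.pull k F' a) = Gr.pull k (F ⋙ F') a :=
  DFunLike.congr_fun (f := (Gr.pull k F).comp (Gr.pull k F')) (g := Gr.pull k (F ⋙ F'))
    (Gr.hom_ext fun M => by simp [Functor.assoc]) a

/-- The dimension at an object `x`: the homomorphism `[M] ↦ dim M(x)`. -/
def Gr.dim {D : Type u} [Category.{v} D] (x : D) : Gr k D →+ ℤ :=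
  QuotientAddGroup.lift _
    (FreeAbelianGroup.lift fun M : Rep k D => (Module.finrank k (M.obj x) : ℤ)) <| by
    rw [grRel, AddSubgroup.closure_le]
    rintro _ ⟨L, M, N, ⟨e⟩, rfl⟩
    have := preservesBinaryBiproducts_of_preservesBiproducts
      ((evaluation D (FGModuleCat.{w} k)).obj x ⋙ forget₂ (FGModuleCat.{w} k) (ModuleCat.{w} k))
    have e' := (((evaluation D (FGModuleCat.{w} k)).obj x ⋙
      forget₂ (FGModuleCat.{w} k) (ModuleCat.{w} k)).mapIso e ≪≫
      ((evaluation D (FGModuleCat.{w} k)).obj x ⋙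
        forget₂ (FGModuleCat.{w} k) (ModuleCat.{w} k)).mapBiprod M N ≪≫
      ModuleCat.biprodIsoProd _ _).toLinearEquiv
    have h : Module.finrank k (L.obj x) = Module.finrank k (M.obj x) + Module.finrank k (N.obj x) :=
      (LinearEquiv.finrank_eq (R := k) (M := L.obj x) (N := M.obj x × N.obj x) e').trans
        Module.finrank_prod
    simp [h]

theorem Gr.dim_mk {D : Type u} [Category.{v} D] (x : D) (M : Rep k D) :
    Gr.dim k x (Gr.mk M) = Module.finrank k (M.obj x) := by
  simp [Gr.dim, Gr.mk]

end Grothendieck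

/-! ### Semi-simplicial categories and representation cohomology -/

set_option linter.checkUnivs false in
/-- A semi-simplicial object in the category of small categories. -/
structure SemiSimplicialCat where
  obj : ℕ → Type u
  [cat : ∀ n, Category.{v} (obj n)]
  face : ∀ n, Fin (n + 2) → (obj (n + 1) ⥤ obj n)
  face_face : ∀ (n : ℕ) (i j : Fin (n + 2)), i ≤ j →
    face (n + 1) j.succ ⋙ face n i = face (n + 1) i.castSucc ⋙ face n j

attribute [instance] SemiSimplicialCat.cat

/-- Morphisms of semi-simplicial categories. -/
structure SemiSimplicialCat.Hom (X : SemiSimplicialCat.{v, u}) (Y : SemiSimplicialCat.{v', u'}) where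
  app : ∀ n, X.obj n ⥤ Y.obj n
  comm : ∀ (n : ℕ) (i : Fin (n + 2)), app (n + 1) ⋙ Y.face n i = X.face n i ⋙ app n

/-- The semi-cosimplicial abelian group `Gr(kX_•)`. -/
def grCosimplicial (k : Type w) [Field k] (X : SemiSimplicialCat.{v, u}) :
    SemiCosimplicialAb where
  obj n := Gr k (X.obj n)
  coface n i := Gr.pull k (X.face n i)
  coface_coface n i j hij a := by
    rw [Gr.pull_pull, Gr.pull_pull, X.face_face n i j hij]

/-- The morphism `Gr(kY_•) → Gr(kX_•)` induced by `F : X_• → Y_•`. -/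
def grMap (k : Type w) [Field k] {X : SemiSimplicialCat.{v, u}} {Y : SemiSimplicialCat.{v', u'}}
    (F : X.Hom Y) : (grCosimplicial k Y).Hom (grCosimplicial k X) where
  app n := Gr.pull k (F.app n)
  comm n i a := by
    exact (Gr.pull_pull k _ _ a).trans <| (congrArg (fun G => Gr.pull k G a) (F.comm n i)).trans
      (Gr.pull_pull k _ _ a).symm

/-- Representation cohomology `Rⁿ(X_•, k) = Hⁿ(Gr(kX_•))`. -/
abbrev repCohomology (k : Type w) [Field k] (X : SemiSimplicialCat.{v, u}) (n : ℕ) :=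
  (grCosimplicial k X).H n

/-! ### Direct categories and composition length -/

section Direct

variable {C : Type u} [Category.{v} C]

/-- The morphism `f` is an identity morphism. -/
def IsIdentity {x y : C} (f : x ⟶ y) : Prop := ∃ h : x = y, f = eqToHom h

/-- The morphism `f` is irreducible: it is not an identity, and in every factorization
one of the factors is an identity. -/
def IsIrreducible {x y : C} (f : x ⟶ y) : Prop :=
  ¬ IsIdentity f ∧ ∀ (z : C) (b : x ⟶ z) (a : z ⟶ y), b ≫ a = f → IsIdentity b ∨ IsIdentity a

variable (C)

/-- A direct category: there are no infinite chains of composable non-identity morphisms,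
neither ascending nor descending. (A cycle of positive length would give such a chain.) -/
class IsDirect : Prop where
  no_ascending : ¬ ∃ (x : ℕ → C) (f : ∀ n, x n ⟶ x (n + 1)), ∀ n, ¬ IsIdentity (f n)
  no_descending : ¬ ∃ (x : ℕ → C) (f : ∀ n, x (n + 1) ⟶ x n), ∀ n, ¬ IsIdentity (f n)

/-- `N` is the composition length of `C`: the length of a longest chain of
composable irreducible morphisms. -/
def IsCompositionLength (N : ℕ) : Prop :=
  IsGreatest {m : ℕ | ∃ x : ComposableArrows C m,
    ∀ i : Fin m, IsIrreducible (x.map (homOfLE i.castSucc_le_succ))} N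

variable {C}

theorem IsDirect.endo [IsDirect C] {x : C} (f : x ⟶ x) : f = 𝟙 x := by
  by_contra h
  refine IsDirect.no_ascending (C := C) ⟨fun _ => x, fun _ => f, fun _ hf => h ?_⟩
  obtain ⟨_, h⟩ := hf
  simpa using h

theorem IsDirect.eq_of_cycle [IsDirect C] {x y : C} (f : x ⟶ y) (g : y ⟶ x) : x = y := by
  by_contra h
  refine IsDirect.no_ascending (C := C) ⟨fun n => if Even n then x else y,
    fun n => if hn : Even n then eqToHom (by simp [hn]) ≫ f ≫ eqToHom (by simp [hn, parity_simps])
      else eqToHom (by simp [hn]) ≫ g ≫ eqToHom (by simp [hn, parity_simps]), fun n hf => h ?_⟩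
  obtain ⟨h', -⟩ := hf
  by_cases hn : Even n
  · simpa [hn, parity_simps] using h'
  · simpa [hn, parity_simps, eq_comm] using h'

end Direct

/-! ### Non-degenerate simplices of the nerve -/

section Simplices

variable (C : Type u) [Category.{v} C]

/-- The monotone map `[n] → [n+1]` missing `i`, as a functor. -/
abbrev coskip (n : ℕ) (i : Fin (n + 2)) : Fin (n + 1) ⥤ Fin (n + 2) :=
  (Fin.succAboveOrderEmb i).monotone.functor

/-- The face functor `∂ᵢ : C^[n+1] ⥤ C^[n]`. -/
def faceFunctor (n : ℕ) (i : Fin (n + 2)) : ComposableArrows C (n + 1) ⥤ ComposableArrows C n :=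
  (Functor.whiskeringLeft _ _ C).obj (coskip n i)

/-- On objects, `faceFunctor` is the face operator of the nerve. -/
theorem faceFunctor_obj (n : ℕ) (i : Fin (n + 2)) (x : ComposableArrows C (n + 1)) :
    (faceFunctor C n i).obj x = (nerve C).δ i x := rfl

theorem faceFunctor_comp (n : ℕ) (i j : Fin (n + 2)) (h : i ≤ j) :
    faceFunctor C (n + 1) j.succ ⋙ faceFunctor C n i =
      faceFunctor C (n + 1) i.castSucc ⋙ faceFunctor C n j := by
  have key : coskip n i ⋙ coskip (n + 1) j.succ = coskip n j ⋙ coskip (n + 1) i.castSucc := by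
    refine CategoryTheory.Functor.ext (fun a => ?_) (fun _ _ _ => Subsingleton.elim _ _)
    have := congrArg (fun f => f.toOrderHom a) (SimplexCategory.δ_comp_δ h)
    exact this
  exact congrArg (fun F => (Functor.whiskeringLeft _ _ C).obj F) key

/-- The `n`-simplices of the nerve that are non-degenerate. -/
def isNonDegenerate (n : ℕ) : ObjectProperty (ComposableArrows C n) :=
  fun x => x ∈ (nerve C).nonDegenerate n

variable {C}

theorem isNonDegenerate_iff [IsDirect C] {n : ℕ} (x : ComposableArrows C n) :
    isNonDegenerate C n x ↔ Function.Injective x.obj := by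
  change x ∈ (nerve C).nonDegenerate n ↔ _
  constructor
  · intro hx
    by_contra hinj
    apply hx
    obtain ⟨a, b, hab, hlt⟩ : ∃ a b : Fin (n + 1), x.obj a = x.obj b ∧ a < b := by
      simp only [Function.Injective, not_forall] at hinj
      obtain ⟨a, b, hab, hne⟩ := hinj
      rcases lt_or_gt_of_ne hne with h | h
      · exact ⟨a, b, hab, h⟩
      · exact ⟨b, a, hab.symm, h⟩
    obtain ⟨m, rfl⟩ : ∃ m, n = m + 1 := ⟨n - 1, by have := a.2; have := b.2; omega⟩
    obtain ⟨c, rfl⟩ : ∃ c : Fin (m + 1), a = c.castSucc :=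
      ⟨a.castLT (by have := b.2; omega), by simp⟩
    have hcb : c.succ ≤ b := by
      rw [Fin.lt_def] at hlt; rw [Fin.le_def]; simpa using! hlt
    have hc : x.obj c.castSucc = x.obj c.succ :=
      IsDirect.eq_of_cycle (x.map (homOfLE c.castSucc_le_succ))
        (x.map (homOfLE hcb) ≫ eqToHom hab.symm)
    rw [SSet.degenerate_eq_iUnion_range_σ]
    refine Set.mem_iUnion.2 ⟨c, (nerve C).δ c.succ x, ?_⟩
    let θ : Fin (m + 2) ⥤ Fin (m + 2) :=
      (Fin.predAboveOrderHom c).monotone.functor ⋙ coskip m c.succ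
    change θ ⋙ x = x
    have hθ : ∀ p, θ.obj p = p ∨ (p = c.succ ∧ θ.obj p = c.castSucc) := by
      intro p
      change Fin.succAbove c.succ (Fin.predAbove c p) = p ∨
        (p = c.succ ∧ Fin.succAbove c.succ (Fin.predAbove c p) = c.castSucc)
      rcases lt_trichotomy p c.succ with h | h | h
      · left
        have h' : p ≤ c.castSucc := by
          rw [Fin.lt_def] at h; rw [Fin.le_def]; simp at h ⊢; omega
        rw [Fin.predAbove_of_le_castSucc _ _ h', Fin.succAbove_of_castSucc_lt _ _ (by simpa using h)]
        simp
      · right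
        subst h
        simp
      · left
        have h' : c.castSucc < p := lt_trans Fin.castSucc_lt_succ h
        rw [Fin.predAbove_of_castSucc_lt _ _ h', Fin.succAbove_of_le_castSucc]
        · simp
        · rw [Fin.lt_def] at h; rw [Fin.le_def]; simp at h ⊢; omega
    have hle : ∀ p, θ.obj p ≤ p := by
      intro p
      rcases hθ p with h | ⟨h, h'⟩
      · exact h.le
      · rw [h', h]; exact c.castSucc_le_succ
    have hobj : ∀ p, x.obj (θ.obj p) = x.obj p := by
      intro p
      rcases hθ p with h | ⟨h, h'⟩
      · rw [h]
      · rw [h', h]; exact hc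
    have hmap : ∀ p, x.map (homOfLE (hle p)) = eqToHom (hobj p) := by
      intro p
      have := IsDirect.endo (x.map (homOfLE (hle p)) ≫ eqToHom (hobj p).symm)
      rw [← cancel_mono (eqToHom (hobj p).symm), this]
      simp
    refine CategoryTheory.Functor.ext hobj fun p q f => ?_
    have h1 : θ.map f ≫ homOfLE (hle q) = homOfLE (hle p) ≫ f := Subsingleton.elim _ _
    have h2 := congrArg x.map h1
    rw [x.map_comp, x.map_comp, hmap, hmap] at h2
    rw [← Category.assoc, ← h2]
    simp
  · rintro hinj ⟨m, hm, f, y, hy⟩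
    obtain ⟨a, b, hab, hne⟩ : ∃ a b : Fin (n + 1), f.toOrderHom a = f.toOrderHom b ∧ a ≠ b := by
      by_contra hcon
      push Not at hcon
      have := Fintype.card_le_of_injective _ (fun a b h => hcon a b h)
      simp at this
      omega
    apply hne
    apply hinj
    subst hy
    exact congrArg (fun a => (show ComposableArrows C m from y).obj a) hab

/-- In a direct category, faces of non-degenerate simplices are non-degenerate. -/
theorem isNonDegenerate_face [IsDirect C] {n : ℕ} (i : Fin (n + 2))
    {x : ComposableArrows C (n + 1)} (hx : isNonDegenerate C (n + 1) x) :
    isNonDegenerate C n ((faceFunctor C n i).obj x) := by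
  rw [isNonDegenerate_iff] at hx ⊢
  exact hx.comp (Fin.succAboveOrderEmb i).injective

/-- Functors into a full subcategory are equal if they are equal in the ambient category. -/
theorem functor_ext_fullSubcategory {A : Type u'} [Category.{v'} A] {D : Type u} [Category.{v} D]
    {P : ObjectProperty D} {F G : A ⥤ P.FullSubcategory} (h : F ⋙ P.ι = G ⋙ P.ι) : F = G := by
  have hobj : ∀ a, F.obj a = G.obj a := fun a =>
    ObjectProperty.FullSubcategory.ext (CategoryTheory.Functor.congr_obj h a)
  refine CategoryTheory.Functor.ext hobj fun a b f => P.ι.map_injective ?_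
  simpa [eqToHom_map] using CategoryTheory.Functor.congr_hom h f

/-- Functors into a wide subcategory are equal if they are equal in the ambient category. -/
theorem functor_ext_wideSubcategory {A : Type u'} [Category.{v'} A] {D : Type u} [Category.{v} D]
    {P : MorphismProperty D} [P.IsMultiplicative] {F G : A ⥤ WideSubcategory P}
    (h : F ⋙ wideSubcategoryInclusion P = G ⋙ wideSubcategoryInclusion P) : F = G := by
  have hobj : ∀ a, F.obj a = G.obj a := fun a =>
    WideSubcategory.ext (CategoryTheory.Functor.congr_obj h a)
  refine CategoryTheory.Functor.ext hobj fun a b f => (wideSubcategoryInclusion P).map_injective ?_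
  have := CategoryTheory.Functor.congr_hom h f
  rw [Functor.map_comp, Functor.map_comp, eqToHom_map, eqToHom_map]
  exact this

variable (C)

/-! ### The semi-simplicial categories `E_•`, `G_•` and `G^∅_•` of a direct category -/

/-- The category `E_n`: the full subcategory of the functor category `C^[n]` on the
non-degenerate `n`-simplices of the nerve of `C`. -/
abbrev ECat (n : ℕ) := (isNonDegenerate C n).FullSubcategory

/-- The morphisms of `G_n`: the identities, and the morphisms `x ⟶ y` induced by a
morphism `w : xₙ ⟶ y₀`, that is, with components `xᵢ ⟶ xₙ ⟶ y₀ ⟶ yᵢ`. -/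
def compositional (n : ℕ) : MorphismProperty (ECat C n) := fun x y f =>
  IsIdentity f ∨ ∃ w : x.obj.obj (Fin.last n) ⟶ y.obj.obj 0, ∀ i : Fin (n + 1),
    f.hom.app i = x.obj.map (homOfLE i.le_last) ≫ w ≫ y.obj.map (homOfLE i.zero_le)

instance (n : ℕ) : (compositional C n).IsMultiplicative where
  id_mem x := Or.inl ⟨rfl, rfl⟩
  comp_mem {x y z} f g hf hg := by
    rcases hf with ⟨rfl, hf⟩ | ⟨w, hw⟩
    · rw [eqToHom_refl] at hf
      rw [hf, Category.id_comp]
      exact hg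
    · rcases hg with ⟨rfl, hg⟩ | ⟨w', hw'⟩
      · rw [eqToHom_refl] at hg
        rw [hg, Category.comp_id]
        exact Or.inr ⟨w, hw⟩
      · refine Or.inr ⟨w ≫ y.obj.map (homOfLE (Fin.zero_le _)) ≫ w', fun i => ?_⟩
        rw [ObjectProperty.FullSubcategory.comp_hom, NatTrans.comp_app, hw, hw']
        simp only [Category.assoc]
        rw [← y.obj.map_comp_assoc]
        rfl

/-- The category `G_n`: the subcategory of `E_n` with the same objects and with the
morphisms of `compositional`. -/
abbrev GCat (n : ℕ) := WideSubcategory (compositional C n)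

variable [IsDirect C]

/-- The face functors of `E_•`. -/
def eFace (n : ℕ) (i : Fin (n + 2)) : ECat C (n + 1) ⥤ ECat C n :=
  ObjectProperty.lift _ (ObjectProperty.ι _ ⋙ faceFunctor C n i)
    fun x => isNonDegenerate_face i x.property

theorem eFace_comp (n : ℕ) (i j : Fin (n + 2)) (h : i ≤ j) :
    eFace C (n + 1) j.succ ⋙ eFace C n i = eFace C (n + 1) i.castSucc ⋙ eFace C n j :=
  functor_ext_fullSubcategory
    (congrArg (fun F => ObjectProperty.ι _ ⋙ F) (faceFunctor_comp C n i j h))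

/-- The semi-simplicial category `E_•`. -/
def E : SemiSimplicialCat where
  obj n := ECat C n
  face n i := eFace C n i
  face_face n i j h := eFace_comp C n i j h

variable {C} in
theorem eFace_compositional {n : ℕ} (i : Fin (n + 2)) {x y : ECat C (n + 1)} (f : x ⟶ y)
    (hf : compositional C (n + 1) f) : compositional C n ((eFace C n i).map f) := by
  rcases hf with ⟨rfl, hf⟩ | ⟨w, hw⟩
  · rw [eqToHom_refl] at hf
    rw [hf, CategoryTheory.Functor.map_id]
    exact Or.inl ⟨rfl, rfl⟩
  · refine Or.inr ⟨x.obj.map (homOfLE (Fin.le_last _)) ≫ w ≫ y.obj.map (homOfLE (Fin.zero_le _)),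
      fun j => ?_⟩
    have h1 := x.obj.map_comp ((coskip n i).map (homOfLE j.le_last))
      (homOfLE (Fin.le_last ((coskip n i).obj (Fin.last n))))
    have h2 := y.obj.map_comp (homOfLE (Fin.zero_le ((coskip n i).obj 0)))
      ((coskip n i).map (homOfLE j.zero_le))
    refine ((hw (i.succAbove j)).trans (congrArg₂ (fun p q => p ≫ w ≫ q) h1 h2)).trans ?_
    change _ = x.obj.map ((coskip n i).map _) ≫ (x.obj.map _ ≫ w ≫ y.obj.map _) ≫
      y.obj.map ((coskip n i).map _)
    have assoc : ∀ {p q r s t t' : C} (a : p ⟶ q) (b : q ⟶ r) (c : r ⟶ s) (d : s ⟶ t) (e : t ⟶ t'),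
        (a ≫ b) ≫ c ≫ d ≫ e = a ≫ (b ≫ c ≫ d) ≫ e := by intros; simp
    exact assoc _ _ _ _ _

/-- The face functors of `G_•`. -/
def gFace (n : ℕ) (i : Fin (n + 2)) : GCat C (n + 1) ⥤ GCat C n where
  obj x := ⟨(eFace C n i).obj x.obj⟩
  map f := ⟨(eFace C n i).map f.hom, eFace_compositional i f.hom f.property⟩
  map_id x := WideSubcategory.hom_ext _ ((eFace C n i).map_id x.obj)
  map_comp f g := WideSubcategory.hom_ext _ ((eFace C n i).map_comp f.hom g.hom)

theorem gFace_comp (n : ℕ) (i j : Fin (n + 2)) (h : i ≤ j) :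
    gFace C (n + 1) j.succ ⋙ gFace C n i = gFace C (n + 1) i.castSucc ⋙ gFace C n j :=
  functor_ext_wideSubcategory
    (congrArg (fun F => wideSubcategoryInclusion _ ⋙ F) (eFace_comp C n i j h))

/-- The semi-simplicial category `G_•`. -/
def G : SemiSimplicialCat where
  obj n := GCat C n
  face n i := gFace C n i
  face_face n i j h := gFace_comp C n i j h

/-- The semi-simplicial category `G^∅_•`: in dimension `n` the discrete category on
the objects of `G_n`. -/
def GDisc : SemiSimplicialCat where
  obj n := Discrete (GCat C n)
  face n i := Discrete.functor fun x => ⟨(gFace C n i).obj x⟩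
  face_face n i j h := CategoryTheory.Functor.ext
    (fun x => congrArg Discrete.mk (CategoryTheory.Functor.congr_obj (gFace_comp C n i j h) x.as))
    (fun _ _ _ => Subsingleton.elim _ _)

/-- The inclusion `ι : G^∅_• → G_•`. -/
def inclusion : (GDisc C).Hom (G C) where
  app n := Discrete.functor fun x : GCat C n => x
  comm n i := CategoryTheory.Functor.ext (fun _ => rfl) <| by
    rintro ⟨x⟩ ⟨y⟩ ⟨⟨h⟩⟩
    obtain rfl : x = y := h
    change (gFace C n i).map (𝟙 x) = 𝟙 _ ≫ 𝟙 _ ≫ 𝟙 _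
    simp

end Simplices

section Cohomology

variable (k : Type w) [Field k] (C : Type u) [Category.{v} C] [IsDirect C]

/-- The cohomology group `𝓔ⁿ(C, k)`. -/
abbrev EH (n : ℕ) := repCohomology k (E C) n

/-- The cohomology group `𝓖ⁿ(C, k)`. -/
abbrev GH (n : ℕ) := repCohomology k (G C) n

/-- The cohomology group `Rⁿ(G^∅_•, k)`. -/
abbrev GDiscH (n : ℕ) := repCohomology k (GDisc C) n

/-- The homomorphism `ι* : 𝓖ⁿ(C, k) → Rⁿ(G^∅_•, k)`. -/
def iotaStar (n : ℕ) : GH k C n →+ GDiscH k C n := (grMap k (inclusion C)).mapH n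

end Cohomology

end RepCoh

end

noncomputable section

namespace RepCoh

/-! ### Normalized cochains of a simplicial set -/

section Normalized

open AlgebraicTopology AlgebraicTopology.DoldKan Opposite

variable {X : SSet.{u}}

/-! Three independent facts carry the theorem.

Vanishing. In a finite direct category every non-identity morphism is a composite of irreducible
ones, so each of the n arrows of a non-degenerate n-simplex contributes at least one irreducible to
a chain (`le_of_isNonDegenerate`). For n > N there are thus no such simplices, and the Grothendieck
groups in degree n are already zero.

Comparison with the nerve. A module over a discrete category is a family of vector spaces,
determined by its dimensions, so Gr(k𝒢^∅) is the complex of integral functions on non-degenerate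
simplices (`Gr.dimHom_discrete_bijective`). Faces of non-degenerate simplices are non-degenerate, so
restriction from all cochains is a morphism of complexes. It is an isomorphism on cohomology:
extension by zero gives surjectivity, and the Dold–Kan homotopy from `PInfty` to the identity gives
injectivity (`mem_coboundaries_of_vanish`).

The map ι*. Letting every non-identity of 𝒢_n act by zero extends any module on the objects to 𝒢_n.
This is compatible with faces because the face functors of 𝒢 reflect identities
(`isIdentity_of_gFace`), so ι* has a section in every degree. A non-identity x → y of 𝒢_n splices x
and y into one chain with at least 2n irreducibles; once 2n > N only identities are left, and the
section becomes a two-sided inverse. -/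

theorem cochains_d_apply (n : ℕ) (g : (cochains X).obj n)
    (x : X.obj (op (SimplexCategory.mk (n + 1)))) :
    (cochains X).d n g x = ∑ i : Fin (n + 2), (-1 : ℤ) ^ (i : ℕ) * g (X.δ i x) := by
  rw [SemiCosimplicialAb.d_apply]
  refine (Finset.sum_apply x Finset.univ
    (fun i : Fin (n + 2) => ((-1 : ℤ) ^ (i : ℕ) • (cochains X).coface n i g : _ → ℤ))).trans ?_
  rfl

/-- The coboundary of a cochain that vanishes on degenerate simplices vanishes on degenerate
simplices. -/
theorem cochains_d_eq_zero_of_degenerate (n : ℕ) (g : (cochains X).obj n)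
    (hg : ∀ y ∈ X.degenerate n, g y = 0)
    {x : X.obj (op (SimplexCategory.mk (n + 1)))} (hx : x ∈ X.degenerate (n + 1)) :
    (cochains X).d n g x = 0 := by
  rw [SSet.degenerate_eq_iUnion_range_σ] at hx
  obtain ⟨j, y, rfl⟩ := Set.mem_iUnion.1 hx
  rw [cochains_d_apply]
  have hne : j.castSucc ≠ j.succ := Fin.castSucc_lt_succ.ne
  have hdeg : ∀ i : Fin (n + 2), i ≠ j.castSucc → i ≠ j.succ →
      X.δ i (X.σ j y) ∈ X.degenerate n := by
    intro i h1 h2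
    -- For n = 0 the only two faces are the excluded ones, so n is positive here.
    obtain ⟨m, rfl⟩ : ∃ m, n = m + 1 := ⟨n - 1, by
      have := i.2; have := j.2
      simp only [ne_eq, Fin.ext_iff, Fin.val_castSucc, Fin.val_succ] at h1 h2
      omega⟩
    rcases lt_or_gt_of_ne h1 with h | h
    · obtain ⟨i', rfl⟩ : ∃ i' : Fin (m + 2), i = i'.castSucc :=
        ⟨i.castLT (by rw [Fin.lt_def] at h; have := j.2; simp at h; omega), by simp⟩
      obtain ⟨j', rfl⟩ : ∃ j' : Fin (m + 1), j = j'.succ :=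
        ⟨j.pred (by rintro rfl; simp at h), by simp⟩
      have := ConcreteCategory.congr_hom (X.δ_comp_σ_of_le (i := i') (j := j')
        (by rw [Fin.lt_def] at h; rw [Fin.le_def]; simp at h ⊢; omega)) y
      exact this ▸ SSet.σ_mem_degenerate X _ _
    · have h3 : j.succ < i := lt_of_le_of_ne
        (by rw [Fin.lt_def] at h; rw [Fin.le_def]; simp at h ⊢; omega) (Ne.symm h2)
      obtain ⟨i', rfl⟩ : ∃ i' : Fin (m + 2), i = i'.succ :=
        ⟨i.pred (by rintro rfl; simp at h), by simp⟩
      obtain ⟨j', rfl⟩ : ∃ j' : Fin (m + 1), j = j'.castSucc :=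
        ⟨j.castLT (by rw [Fin.lt_def] at h3; have := i'.2; simp at h3; omega), by simp⟩
      have := ConcreteCategory.congr_hom (X.δ_comp_σ_of_gt (i := i') (j := j')
        (by rw [Fin.lt_def] at h3 ⊢; simp at h3 ⊢; omega)) y
      exact this ▸ SSet.σ_mem_degenerate X _ _
  -- Only the faces j and j + 1 survive; both return y, and their signs are opposite.
  rw [Finset.sum_eq_add_of_mem j.castSucc j.succ (Finset.mem_univ _) (Finset.mem_univ _) hne]
  · have h1 := ConcreteCategory.congr_hom (X.δ_comp_σ_self (i := j)) y
    have h2 := ConcreteCategory.congr_hom (X.δ_comp_σ_succ (i := j)) y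
    have h3 : g (X.δ j.castSucc (X.σ j y)) = g (X.δ j.succ (X.σ j y)) :=
      congrArg g (h1.trans h2.symm)
    rw [h3]
    simp [pow_succ]
  · intro i _ hi
    rw [hg _ (hdeg i hi.1 hi.2), mul_zero]

variable (X) in
/-- The simplicial abelian group freely generated by `X`. -/
def freeAb : SimplicialObject AddCommGrpCat.{u} :=
  ((SimplicialObject.whiskering _ _).obj AddCommGrpCat.free).obj X

variable (X) in
/-- A simplex of `X` as an element of the free simplicial abelian group. -/
def freeAbOf {n : ℕ} (x : X.obj (op (SimplexCategory.mk n))) :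
    (freeAb X).obj (op (SimplexCategory.mk n)) :=
  FreeAbelianGroup.of x

/-- The linear extension of a cochain. -/
def cochainLift {n : ℕ} (c : (cochains X).obj n) :
    (freeAb X).obj (op (SimplexCategory.mk n)) →+ ℤ :=
  FreeAbelianGroup.lift c

theorem cochainLift_of {n : ℕ} (c : (cochains X).obj n)
    (x : X.obj (op (SimplexCategory.mk n))) : cochainLift c (freeAbOf X x) = c x :=
  FreeAbelianGroup.lift_apply_of c x

theorem freeAb_d_of (n : ℕ) (x : X.obj (op (SimplexCategory.mk (n + 1)))) :
    ((alternatingFaceMapComplex AddCommGrpCat.{u}).obj (freeAb X)).d (n + 1) n (freeAbOf X x) =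
      ∑ i : Fin (n + 2), (-1 : ℤ) ^ (i : ℕ) • freeAbOf X (X.δ i x) := by
  rw [alternatingFaceMapComplex_obj_d, AlternatingFaceMapComplex.objD]
  refine (DFunLike.congr_fun (map_sum (AddCommGrpCat.homAddEquiv
    (M := (freeAb X).obj (op (SimplexCategory.mk (n + 1))))
    (N := (freeAb X).obj (op (SimplexCategory.mk n)))) _ _) _).trans ?_
  refine (AddMonoidHom.finsetSum_apply _ _ _).trans (Finset.sum_congr rfl fun i _ => ?_)
  change (-1 : ℤ) ^ (i : ℕ) • ((freeAb X).δ i).hom (freeAbOf X x) = _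
  congr 1

/-- Coboundary is dual to the alternating face boundary, so chain-level homotopies of `freeAb X` can
be evaluated against cochains. -/
theorem cochainLift_d (n : ℕ) (c : (cochains X).obj n)
    (y : (freeAb X).obj (op (SimplexCategory.mk (n + 1)))) :
    cochainLift c
      (((alternatingFaceMapComplex AddCommGrpCat.{u}).obj (freeAb X)).d (n + 1) n y) =
      cochainLift ((cochains X).d n c) y := by
  refine DFunLike.congr_fun (f := (cochainLift c).comp
    (((alternatingFaceMapComplex AddCommGrpCat.{u}).obj (freeAb X)).d (n + 1) n).hom)
    (g := cochainLift ((cochains X).d n c)) (FreeAbelianGroup.lift_ext _ _ fun x => ?_) y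
  change cochainLift c (((alternatingFaceMapComplex AddCommGrpCat.{u}).obj (freeAb X)).d (n + 1) n
    (freeAbOf X x)) = cochainLift _ (freeAbOf X x)
  rw [freeAb_d_of, map_sum, cochainLift_of, cochains_d_apply]
  simp only [map_zsmul, cochainLift_of, smul_eq_mul]

/-- The projector onto the normalized complex annihilates the image of every degeneracy operator. -/
theorem PInfty_of_degenerate (n : ℕ) {x : X.obj (op (SimplexCategory.mk (n + 1)))}
    (hx : x ∈ X.degenerate (n + 1)) :
    (PInfty (X := freeAb X)).f (n + 1) (freeAbOf X x) = 0 := by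
  rw [SSet.degenerate_eq_iUnion_range_σ] at hx
  obtain ⟨j, y, rfl⟩ := Set.mem_iUnion.1 hx
  exact ConcreteCategory.congr_hom (σ_comp_PInfty (freeAb X) j) (freeAbOf X y)

/-- A cocycle is cohomologous to a cochain that vanishes on the degenerate simplices. -/
theorem exists_d_eq_of_degenerate (n : ℕ) (c : (cochains X).obj (n + 1))
    (hc : (cochains X).d (n + 1) c = 0) :
    ∃ g : (cochains X).obj n, ∀ x ∈ X.degenerate (n + 1), (cochains X).d n g x = c x := by
  let K := (alternatingFaceMapComplex AddCommGrpCat.{u}).obj (freeAb X)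
  let h := homotopyPInftyToId (freeAb X)
  -- On a degenerate x the homotopy identity reads 0 = h(∂x) + ∂(hx) + x. Applying c, which kills
  -- boundaries, leaves c(x) = -c(h(∂x)); hence g = -c ∘ h.
  refine ⟨fun y => - cochainLift c (h.hom n (n + 1) (freeAbOf X y)), fun x hx => ?_⟩
  have key := ConcreteCategory.congr_hom (h.comm (n + 1)) (freeAbOf X x)
  rw [PInfty_of_degenerate n hx, dNext_eq h.hom (i := n + 1) (i' := n) (by simp),
    prevD_eq h.hom (j := n + 1) (j' := n + 2) (by simp)] at key
  replace key := congrArg (cochainLift c) key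
  have e1 : cochainLift c (K.d (n + 2) (n + 1) (h.hom (n + 1) (n + 2) (freeAbOf X x))) = 0 := by
    refine (cochainLift_d (n + 1) c (h.hom (n + 1) (n + 2) (freeAbOf X x))).trans ?_
    rw [hc]
    exact DFunLike.congr_fun (FreeAbelianGroup.lift_ext (cochainLift (0 : (cochains X).obj (n + 2))) 0
      fun y => cochainLift_of _ y) _
  replace key : (0 : ℤ) = cochainLift c (h.hom n (n + 1) (K.d (n + 1) n (freeAbOf X x))) +
      cochainLift c (K.d (n + 2) (n + 1) (h.hom (n + 1) (n + 2) (freeAbOf X x))) +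
      cochainLift c (freeAbOf X x) := by
    refine (map_zero (cochainLift c)).symm.trans (key.trans ?_)
    refine (map_add (cochainLift c) _ _).trans (congrArg₂ _ (map_add (cochainLift c) _ _) rfl)
  have e2 : cochainLift c (h.hom n (n + 1) (K.d (n + 1) n (freeAbOf X x))) =
      ∑ i : Fin (n + 2), (-1 : ℤ) ^ (i : ℕ) *
        cochainLift c (h.hom n (n + 1) (freeAbOf X (X.δ i x))) := by
    have := freeAb_d_of n x
    refine (congrArg (fun y => cochainLift c (h.hom n (n + 1) y)) this).trans ?_
    refine (map_sum ((cochainLift c).comp (h.hom n (n + 1)).hom) _ _).trans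
      (Finset.sum_congr rfl fun i _ => ?_)
    refine (map_zsmul ((cochainLift c).comp (h.hom n (n + 1)).hom) _ _).trans ?_
    rw [smul_eq_mul]
    rfl
  rw [e1, e2, cochainLift_of, add_zero] at key
  refine (cochains_d_apply n _ x).trans ?_
  simp only [mul_neg, Finset.sum_neg_distrib]
  linarith

/-- If faces of non-degenerate simplices are non-degenerate, then a cocycle that vanishes on
the non-degenerate simplices is a coboundary. -/
theorem mem_coboundaries_of_vanish (hX : ∀ (n : ℕ) (i : Fin (n + 2)), ∀ x ∈ X.nonDegenerate (n + 1),
      X.δ i x ∈ X.nonDegenerate n)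
    (n : ℕ) (c : (cochains X).obj n) (hc : c ∈ (cochains X).cocycles n)
    (h0 : ∀ x ∈ X.nonDegenerate n, c x = 0) : c ∈ (cochains X).coboundaries n := by
  classical
  cases n with
  | zero =>
    have : c = 0 := funext fun x => h0 x (by simp)
    rw [this]; exact zero_mem _
  | succ n =>
    obtain ⟨g, hg⟩ := exists_d_eq_of_degenerate n c hc
    -- Only the part of g on degenerate simplices is kept. The discarded part has coboundary zero on
    -- degenerate simplices, so there d gK = d g = c; on non-degenerate simplices all faces are
    -- non-degenerate, so d gK = 0 = c.
    let gK : (cochains X).obj n := fun y => if y ∈ X.degenerate n then g y else 0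
    let gN : (cochains X).obj n := fun y => if y ∈ X.degenerate n then 0 else g y
    have hgg : g = gK + gN := by
      funext y
      change g y = gK y + gN y
      by_cases hy : y ∈ X.degenerate n <;> simp [gK, gN, hy]
    refine ⟨gK, funext fun x => ?_⟩
    by_cases hx : x ∈ X.degenerate (n + 1)
    · rw [← hg x hx, hgg, map_add]
      change _ = (cochains X).d n gK x + (cochains X).d n gN x
      rw [cochains_d_eq_zero_of_degenerate n gN (fun y hy => if_pos hy) hx, add_zero]
    · rw [h0 x hx, cochains_d_apply]
      refine Finset.sum_eq_zero fun i _ => ?_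
      have : gK (X.δ i x) = 0 := if_neg (hX n i x hx)
      rw [this, mul_zero]

end Normalized

/-! ### Grothendieck groups of discrete categories -/

section GrDiscrete

open scoped ZeroObject

variable (k : Type w) [Field k]

variable {k} in
theorem Gr.mk_eq_add {D : Type u} [Category.{v} D] {L M N : Rep k D} (e : L ≅ M ⊞ N) :
    Gr.mk L = Gr.mk M + Gr.mk N := by
  refine (QuotientAddGroup.eq_iff_sub_mem (N := grRel k D)).2 ?_
  exact AddSubgroup.subset_closure ⟨L, M, N, ⟨e⟩, rfl⟩

variable {k} in
theorem Gr.mk_eq_zero {D : Type u} [Category.{v} D] {M : Rep k D} (hM : IsZero M) :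
    Gr.mk M = 0 := by
  have h : IsZero (M ⊞ M) := biprod_isZero_iff M M |>.2 ⟨hM, hM⟩
  -- M ≅ M ⊞ M gives [M] = 2[M].
  simpa using Gr.mk_eq_add (hM.iso h)

variable {k} in
theorem Gr.mk_congr {D : Type u} [Category.{v} D] {L M : Rep k D} (e : L ≅ M) :
    Gr.mk L = Gr.mk M := by
  have h0 : IsZero (0 : Rep k D) := isZero_zero _
  rw [Gr.mk_eq_add (e ≪≫ isoBiprodZero (Y := (0 : Rep k D)) h0), Gr.mk_eq_zero h0, add_zero]

-- Direct sums collect all positive terms into one module and all negative terms into another.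
variable {k} in
theorem Gr.exists_eq_sub {D : Type u} [Category.{v} D] (a : Gr k D) :
    ∃ M N : Rep k D, a = Gr.mk M - Gr.mk N := by
  obtain ⟨a, rfl⟩ := QuotientAddGroup.mk_surjective a
  have h0 : Gr.mk (0 : Rep k D) = 0 := Gr.mk_eq_zero (isZero_zero _)
  induction a using FreeAbelianGroup.induction_on with
  | zero => exact ⟨0, 0, by rw [sub_self]; rfl⟩
  | of M => exact ⟨M, 0, by rw [h0, sub_zero]; rfl⟩
  | neg M _ => exact ⟨0, M, by rw [h0, zero_sub]; rfl⟩
  | add x y hx hy =>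
    obtain ⟨M, N, hx⟩ := hx
    obtain ⟨M', N', hy⟩ := hy
    refine ⟨M ⊞ M', N ⊞ N', ?_⟩
    rw [QuotientAddGroup.mk_add, hx, hy, Gr.mk_eq_add (Iso.refl (M ⊞ M')),
      Gr.mk_eq_add (Iso.refl (N ⊞ N'))]
    abel

theorem Gr.subsingleton_of_isEmpty (D : Type u) [Category.{v} D] [IsEmpty D] :
    Subsingleton (Gr k D) := by
  refine ⟨fun a b => DFunLike.congr_fun (f := AddMonoidHom.id (Gr k D)) (g := 0)
    (Gr.hom_ext fun M => ?_) (a - b) |> sub_eq_zero.1⟩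
  exact Gr.mk_eq_zero (Functor.isZero _ fun x => isEmptyElim x)

/-- The dimension function of an element of the Grothendieck group. -/
def Gr.dimHom (D : Type u) [Category.{v} D] : Gr k D →+ (D → ℤ) :=
  AddMonoidHom.pi fun x => Gr.dim k x

theorem Gr.dimHom_apply {D : Type u} [Category.{v} D] (a : Gr k D) (x : D) :
    Gr.dimHom k D a x = Gr.dim k x a := rfl

/-- Vector spaces of equal dimension are isomorphic, and with no morphisms to respect these
isomorphisms assemble freely. Surjectivity writes f as the difference of its positive and negative
parts, which `toNat` extracts. -/
theorem Gr.dimHom_discrete_bijective (X : Type u) :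
    Function.Bijective (Gr.dimHom k (Discrete X)) := by
  constructor
  · refine (injective_iff_map_eq_zero _).2 fun a ha => ?_
    obtain ⟨M, N, rfl⟩ := Gr.exists_eq_sub a
    rw [map_sub, sub_eq_zero] at ha
    rw [sub_eq_zero]
    have h : ∀ x, Nonempty (M.obj x ≅ N.obj x) := fun x => by
      have hx : Gr.dim k x (Gr.mk M) = Gr.dim k x (Gr.mk N) := congrFun ha x
      rw [Gr.dim_mk, Gr.dim_mk, Nat.cast_inj] at hx
      exact ⟨(LinearEquiv.ofFinrankEq _ _ hx).toFGModuleCatIso⟩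
    exact Gr.mk_congr (Discrete.natIso fun x => (h x).some)
  · intro f
    let V : (Discrete X → ℤ) → Rep k (Discrete X) := fun g =>
      Discrete.functor fun x => FGModuleCat.of k (ULift.{w} (Fin (g ⟨x⟩).toNat) → k)
    have hV : ∀ g x, Gr.dim k x (Gr.mk (V g)) = (g x).toNat := by
      intro g x
      rw [Gr.dim_mk, Nat.cast_inj]
      change Module.finrank k (ULift.{w} (Fin (g x).toNat) → k) = _
      simp
    refine ⟨Gr.mk (V f) - Gr.mk (V (-f)), funext fun x => ?_⟩
    rw [Gr.dimHom_apply, map_sub, hV, hV]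
    simp

/-- The Grothendieck group of a discrete category is identified with functions on the set
of objects by taking dimensions. -/
def Gr.dimEquiv (X : Type u) : Gr k (Discrete X) ≃+ (X → ℤ) :=
  (AddEquiv.ofBijective _ (Gr.dimHom_discrete_bijective k X)).trans
    (AddEquiv.arrowCongr discreteEquiv (AddEquiv.refl ℤ))

theorem Gr.dimEquiv_apply (X : Type u) (a : Gr k (Discrete X)) (x : X) :
    Gr.dimEquiv k X a x = Gr.dim k (Discrete.mk x) a := rfl

theorem Gr.dim_pull {D : Type u} [Category.{v} D] {D' : Type u'} [Category.{v'} D'] (F : D ⥤ D')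
    (x : D) (a : Gr k D') : Gr.dim k x (Gr.pull k F a) = Gr.dim k (F.obj x) a :=
  DFunLike.congr_fun (f := (Gr.dim k x).comp (Gr.pull k F)) (g := Gr.dim k (F.obj x))
    (Gr.hom_ext fun M => by simp [Gr.dim_mk]) a

end GrDiscrete

/-! ### Extension of modules by zero -/

section ZeroExtension

/-- A category in which any morphism `x ⟶ y` that admits a morphism `y ⟶ x` is an identity. -/
def Acyclic (D : Type u) [Category.{v} D] : Prop :=
  ∀ ⦃x y : D⦄ (f : x ⟶ y) (_ : y ⟶ x), IsIdentity f

variable {D : Type u} [Category.{v} D]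

theorem isIdentity_id (x : D) : IsIdentity (𝟙 x) := ⟨rfl, rfl⟩

/-- An identity composite makes the two factors run in opposite directions between the same objects.
This is what makes extension by zero functorial. -/
theorem Acyclic.of_comp (hD : Acyclic D) {x y z : D} {f : x ⟶ y} {g : y ⟶ z}
    (h : IsIdentity (f ≫ g)) : IsIdentity f ∧ IsIdentity g := by
  obtain ⟨rfl, -⟩ := h
  exact ⟨hD f g, hD g f⟩

variable {V : Type u'} [Category.{v'} V] [Preadditive V]

open Classical in
/-- The extension of a functor on the objects of an acyclic category to a functor under which
all non-identity morphisms act by zero. -/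
def zeroExtObj (hD : Acyclic D) (M : Discrete D ⥤ V) : D ⥤ V where
  obj x := M.obj ⟨x⟩
  map {x y} f := if h : IsIdentity f then M.map (eqToHom (congrArg Discrete.mk h.choose)) else 0
  map_id x := by
    rw [dif_pos (isIdentity_id x)]
    simp
  map_comp {x y z} f g := by
    by_cases hfg : IsIdentity (f ≫ g)
    · obtain ⟨hf, hg⟩ := hD.of_comp hfg
      rw [dif_pos hfg, dif_pos hf, dif_pos hg, ← M.map_comp, eqToHom_trans]
    · rw [dif_neg hfg]
      by_cases hf : IsIdentity f
      · by_cases hg : IsIdentity g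
        · obtain ⟨rfl, rfl⟩ := hf
          exact absurd (by simpa using hg) hfg
        · rw [dif_neg hg, comp_zero]
      · rw [dif_neg hf, zero_comp]

theorem zeroExtObj_map_of_not (hD : Acyclic D) (M : Discrete D ⥤ V) {x y : D} {f : x ⟶ y}
    (h : ¬ IsIdentity f) : (zeroExtObj hD M).map f = 0 := dif_neg h

/-- Extension by zero as a functor. -/
def zeroExt (hD : Acyclic D) : (Discrete D ⥤ V) ⥤ (D ⥤ V) where
  obj := zeroExtObj hD
  map {M N} t :=
    { app x := t.app ⟨x⟩
      naturality x y f := by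
        by_cases h : IsIdentity f
        · obtain ⟨rfl, rfl⟩ := h
          simp only [eqToHom_refl, CategoryTheory.Functor.map_id]
          exact (Category.id_comp _).trans (Category.comp_id _).symm
        · rw [zeroExtObj_map_of_not hD M h, zeroExtObj_map_of_not hD N h]
          exact zero_comp.trans comp_zero.symm }

instance (hD : Acyclic D) : (zeroExt (V := V) hD).Additive where
  map_add := rfl

variable (k : Type w) [Field k]

/-- Extension by zero on Grothendieck groups. -/
def Gr.zeroExt (hD : Acyclic D) : Gr k (Discrete D) →+ Gr k D :=
  QuotientAddGroup.map _ _ (FreeAbelianGroup.map (RepCoh.zeroExt hD).obj) <| by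
    rw [grRel, AddSubgroup.closure_le]
    rintro _ ⟨L, M, N, ⟨e⟩, rfl⟩
    refine AddSubgroup.subset_closure ⟨(RepCoh.zeroExt hD).obj L, (RepCoh.zeroExt hD).obj M,
      (RepCoh.zeroExt hD).obj N, ⟨?_⟩, by simp⟩
    have := preservesBinaryBiproducts_of_preservesBiproducts
      (RepCoh.zeroExt (V := FGModuleCat.{w} k) hD)
    exact (RepCoh.zeroExt hD).mapIso e ≪≫ (RepCoh.zeroExt hD).mapBiprod M N

theorem Gr.zeroExt_mk (hD : Acyclic D) (M : Rep k (Discrete D)) :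
    Gr.zeroExt k hD (Gr.mk M) = Gr.mk ((RepCoh.zeroExt hD).obj M) := by
  simp [Gr.zeroExt, Gr.mk]

/-- Restricting an extension by zero to the objects gives back the original module. -/
theorem Gr.pull_zeroExt (hD : Acyclic D) (a : Gr k (Discrete D)) :
    Gr.pull k (Discrete.functor fun x : D => x) (Gr.zeroExt k hD a) = a :=
  DFunLike.congr_fun (f := (Gr.pull k (Discrete.functor fun x : D => x)).comp (Gr.zeroExt k hD))
    (g := AddMonoidHom.id _) (Gr.hom_ext fun M => by
      rw [AddMonoidHom.comp_apply, Gr.zeroExt_mk, Gr.pull_mk]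
      exact Gr.mk_congr (Discrete.natIso fun _ => Iso.refl _)) a

/-- If all morphisms are identities, then a module is the extension by zero of its restriction
to the objects. -/
theorem Gr.zeroExt_pull (hD : Acyclic D) (h : ∀ ⦃x y : D⦄ (f : x ⟶ y), IsIdentity f)
    (a : Gr k D) : Gr.zeroExt k hD (Gr.pull k (Discrete.functor fun x : D => x) a) = a :=
  DFunLike.congr_fun (f := (Gr.zeroExt k hD).comp (Gr.pull k (Discrete.functor fun x : D => x)))
    (g := AddMonoidHom.id _) (Gr.hom_ext fun M => by
      rw [AddMonoidHom.comp_apply, Gr.pull_mk, Gr.zeroExt_mk]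
      refine Gr.mk_congr (NatIso.ofComponents (fun _ => Iso.refl _) fun {x y} f => ?_)
      obtain ⟨rfl, rfl⟩ := h f
      simp only [eqToHom_refl, CategoryTheory.Functor.map_id]
      exact (Category.id_comp _).trans (Category.comp_id _).symm) a

/-- Extension by zero commutes with pull-back along functors that reflect identities. -/
theorem Gr.pull_zeroExt_comm {D' : Type u'} [Category.{v'} D'] (hD : Acyclic D) (hD' : Acyclic D')
    (F : D ⥤ D') (hF : ∀ ⦃x y : D⦄ (f : x ⟶ y), IsIdentity (F.map f) → IsIdentity f)
    (a : Gr k (Discrete D')) :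
    Gr.zeroExt k hD (Gr.pull k (Discrete.functor fun x => ⟨F.obj x⟩) a) =
      Gr.pull k F (Gr.zeroExt k hD' a) :=
  DFunLike.congr_fun
    (f := (Gr.zeroExt k hD).comp
      (Gr.pull k (Discrete.functor (C := Discrete D') fun x => ⟨F.obj x⟩)))
    (g := (Gr.pull k F).comp (Gr.zeroExt k hD')) (Gr.hom_ext fun M => by
      rw [AddMonoidHom.comp_apply, AddMonoidHom.comp_apply, Gr.pull_mk, Gr.zeroExt_mk,
        Gr.zeroExt_mk, Gr.pull_mk]
      refine Gr.mk_congr (NatIso.ofComponents (fun _ => Iso.refl _) fun {x y} f => ?_)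
      by_cases h : IsIdentity f
      · obtain ⟨rfl, rfl⟩ := h
        simp only [eqToHom_refl, CategoryTheory.Functor.map_id]
        exact (Category.id_comp _).trans (Category.comp_id _).symm
      · have h' : ¬ IsIdentity (F.map f) := fun h' => h (hF f h')
        refine (congrArg (· ≫ _) (zeroExtObj_map_of_not hD _ h)).trans ?_
        refine Eq.trans ?_ (congrArg (𝟙 _ ≫ ·) (zeroExtObj_map_of_not hD' M h')).symm
        exact zero_comp.trans comp_zero.symm) a

end ZeroExtension

/-! ### Chains of irreducible morphisms -/

section Chains

variable {C : Type u} [Category.{v} C]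

/-- There is a chain of at least `m` composable irreducible morphisms starting at `x`. -/
def HasIrreducibleChain (x : C) (m : ℕ) : Prop :=
  ∃ m', m ≤ m' ∧ ∃ F : ComposableArrows C m', F.left = x ∧
    ∀ i : Fin m', IsIrreducible (F.map (homOfLE i.castSucc_le_succ))

theorem hasIrreducibleChain_zero (x : C) : HasIrreducibleChain x 0 :=
  ⟨0, le_rfl, ComposableArrows.mk₀ x, rfl, fun i => i.elim0⟩

theorem HasIrreducibleChain.le {x : C} {m N : ℕ} (h : HasIrreducibleChain x m)
    (hN : IsCompositionLength C N) : m ≤ N := by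
  obtain ⟨m', hm, F, -, hF⟩ := h
  exact hm.trans (hN.2 ⟨F, hF⟩)

theorem HasIrreducibleChain.cons {x y : C} {m : ℕ} (h : HasIrreducibleChain y m) {f : x ⟶ y}
    (hf : IsIrreducible f) : HasIrreducibleChain x (m + 1) := by
  obtain ⟨m', hm, F, rfl, hF⟩ := h
  refine ⟨m' + 1, by omega, F.precomp f, rfl, fun i => ?_⟩
  induction i using Fin.cases with
  | zero => exact hf
  | succ i => exact hF i

theorem IsDirect.eq_of_isIdentity_comp [IsDirect C] {x y : C} (f : x ⟶ y) (g : y ⟶ x) :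
    IsIdentity f := by
  obtain rfl := IsDirect.eq_of_cycle f g
  exact ⟨rfl, IsDirect.endo f⟩

/-- A chain can be extended along a non-identity morphism. -/
theorem HasIrreducibleChain.cons_of_not_isIdentity [Finite C] [IsDirect C] {x y : C} {m : ℕ}
    (h : HasIrreducibleChain y m) {f : x ⟶ y} (hf : ¬ IsIdentity f) :
    HasIrreducibleChain x (m + 1) := by
  -- Induction on the number of objects lying between x and y: a proper factorization through z
  -- removes x from this set for the second factor and y for the first.
  obtain ⟨r, hr⟩ : ∃ r : ℕ, {z : C | Nonempty (x ⟶ z) ∧ Nonempty (z ⟶ y)}.ncard = r := ⟨_, rfl⟩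
  induction r using Nat.strong_induction_on generalizing x y m with
  | _ r ih =>
    by_cases hirr : IsIrreducible f
    · exact h.cons hirr
    · simp only [IsIrreducible, hf, not_false_eq_true, true_and, not_forall, not_or] at hirr
      obtain ⟨z, b, a, rfl, hb, ha⟩ := hirr
      have h1 : HasIrreducibleChain z (m + 1) := by
        refine ih _ ?_ h ha rfl
        rw [← hr]
        refine Set.ncard_lt_ncard ⟨fun t ht => ⟨⟨b ≫ ht.1.some⟩, ht.2⟩, fun hsub => ?_⟩
          (Set.toFinite _)
        obtain ⟨⟨c⟩, -⟩ := hsub (a := x) ⟨⟨𝟙 x⟩, ⟨b ≫ a⟩⟩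
        -- If x still lay between z and y, there would be a morphism back along b, forcing b to be
        -- an identity.
        exact hb (IsDirect.eq_of_isIdentity_comp b c)
      have h2 : HasIrreducibleChain x (m + 1 + 1) := by
        refine ih _ ?_ h1 hb rfl
        rw [← hr]
        refine Set.ncard_lt_ncard ⟨fun t ht => ⟨ht.1, ⟨ht.2.some ≫ a⟩⟩, fun hsub => ?_⟩
          (Set.toFinite _)
        obtain ⟨-, ⟨c⟩⟩ := hsub (a := y) ⟨⟨b ≫ a⟩, ⟨𝟙 y⟩⟩
        exact ha (IsDirect.eq_of_isIdentity_comp a c)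
      obtain ⟨m', hm', H⟩ := h2
      exact ⟨m', by omega, H⟩

theorem HasIrreducibleChain.comp [Finite C] [IsDirect C] {x y : C} {m : ℕ}
    (h : HasIrreducibleChain y m) (f : x ⟶ y) : HasIrreducibleChain x m := by
  by_cases hf : IsIdentity f
  · obtain ⟨rfl, -⟩ := hf
    exact h
  · obtain ⟨m', hm', H⟩ := h.cons_of_not_isIdentity hf
    exact ⟨m', by omega, H⟩

/-- A chain can be extended along a non-degenerate simplex. -/
theorem HasIrreducibleChain.of_last [Finite C] [IsDirect C] {n m : ℕ} (x : ComposableArrows C n)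
    (hx : isNonDegenerate C n x) (h : HasIrreducibleChain (x.obj (Fin.last n)) m) :
    HasIrreducibleChain (x.obj 0) (m + n) := by
  rw [isNonDegenerate_iff] at hx
  -- From vertex i there are n - i arrows left, each lengthening the chain by at least one.
  suffices H : ∀ i : Fin (n + 1), HasIrreducibleChain (x.obj i) (m + (n - i)) by simpa using! H 0
  intro i
  induction i using Fin.reverseInduction with
  | last => simpa using h
  | cast i ih =>
    have h1 := ih.cons_of_not_isIdentity (f := x.map (homOfLE i.castSucc_le_succ)) fun hid =>
      i.castSucc_lt_succ.ne (hx hid.choose)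
    have h2 : m + (n - (i.succ : ℕ)) + 1 = m + (n - (i.castSucc : ℕ)) := by
      have := i.2
      simp only [Fin.val_succ, Fin.val_castSucc]
      omega
    rwa [h2] at h1

theorem le_of_isNonDegenerate [Finite C] [IsDirect C] {N : ℕ} (hN : IsCompositionLength C N)
    {n : ℕ} {x : ComposableArrows C n} (hx : isNonDegenerate C n x) : n ≤ N := by
  simpa using ((hasIrreducibleChain_zero _).of_last x hx).le hN

end Chains

/-! ### Identities in the categories `E_n` and `G_n` -/

section Identities

variable {C : Type u} [Category.{v} C]

/-- Naturality against identity components forces the two simplices to agree on morphisms as well as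
on objects, hence to be equal. -/
theorem isIdentity_of_app {n : ℕ} {x y : ECat C n} (f : x ⟶ y)
    (h : ∀ i, IsIdentity (f.hom.app i)) : IsIdentity f := by
  choose hobj happ using h
  obtain ⟨x, hx⟩ := x
  obtain ⟨y, hy⟩ := y
  obtain rfl : x = y := CategoryTheory.Functor.ext hobj fun i j g => by
    have := f.hom.naturality g
    rw [happ, happ] at this
    simp [← reassoc_of% this]
  exact ⟨rfl, ObjectProperty.hom_ext _ (NatTrans.ext (funext happ))⟩

theorem isIdentity_gCat_iff {n : ℕ} {x y : GCat C n} (f : x ⟶ y) :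
    IsIdentity f ↔ IsIdentity f.hom := by
  constructor
  · rintro ⟨rfl, rfl⟩
    exact ⟨rfl, rfl⟩
  · obtain ⟨x⟩ := x
    obtain ⟨y⟩ := y
    rintro ⟨h, hf⟩
    obtain rfl : x = y := h
    exact ⟨rfl, WideSubcategory.hom_ext _ hf⟩

variable [IsDirect C]

/-- Checked componentwise: opposite morphisms of simplices give opposite morphisms in C at every
vertex. -/
theorem acyclic_gCat (n : ℕ) : Acyclic (GCat C n) := fun _ _ f g =>
  (isIdentity_gCat_iff f).2 (isIdentity_of_app _ fun i =>
    IsDirect.eq_of_isIdentity_comp (f.hom.hom.app i) (g.hom.hom.app i))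

/-- The face functors of `G_•` reflect identities. -/
theorem isIdentity_of_gFace {n : ℕ} (i : Fin (n + 2)) {x y : GCat C (n + 1)} (f : x ⟶ y)
    (h : IsIdentity ((gFace C n i).map f)) : IsIdentity f := by
  rcases f.property with hf | ⟨w, -⟩
  · exact (isIdentity_gCat_iff f).2 hf
  · exfalso
    obtain ⟨h, -⟩ := h
    have hx := (isNonDegenerate_iff _).1 x.obj.property
    have hy := (isNonDegenerate_iff _).1 y.obj.property
    -- The vertex that becomes vertex 0 of the i-th face. An identity on that face gives x_j = y_j,
    -- so w closes the loop x_j → x_last → y_0 → y_j. Directness and non-degeneracy then force j to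
    -- be both the last and the first vertex, although there are at least two.
    let j : Fin (n + 2) := i.succAbove 0
    have hj : x.obj.obj.obj j = y.obj.obj.obj j :=
      congrArg (fun z : GCat C n => z.obj.obj.obj 0) h
    have h1 : x.obj.obj.obj j = x.obj.obj.obj (Fin.last _) :=
      IsDirect.eq_of_cycle (x.obj.obj.map (homOfLE j.le_last))
        (w ≫ y.obj.obj.map (homOfLE j.zero_le) ≫ eqToHom hj.symm)
    have h2 : y.obj.obj.obj 0 = y.obj.obj.obj j :=
      IsDirect.eq_of_cycle (y.obj.obj.map (homOfLE j.zero_le))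
        (eqToHom hj.symm ≫ x.obj.obj.map (homOfLE j.le_last) ≫ w)
    have h3 := (hy h2).trans (hx h1)
    simp [Fin.ext_iff] at h3

/-- In high dimensions, all morphisms of `G_n` are identities. -/
theorem isIdentity_of_lt [Finite C] {N : ℕ} (hN : IsCompositionLength C N) {n : ℕ}
    (hn : N < 2 * n) {x y : GCat C n} (f : x ⟶ y) : IsIdentity f := by
  rcases f.property with hf | ⟨w, -⟩
  · exact (isIdentity_gCat_iff f).2 hf
  -- The simplices x and y contribute n irreducibles each. The connecting w may be an identity and
  -- is counted as zero, hence the bound 2n.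
  · have h := ((((hasIrreducibleChain_zero _).of_last _ y.obj.property).comp w).of_last _
      x.obj.property).le hN
    omega

end Identities

/-! ### Comparison of the cohomology groups -/

section Comparison

variable (k : Type w) [Field k] (C : Type u) [Category.{v} C] [IsDirect C]

/-- Extension by zero as a section of the restriction to the objects. -/
def zeroExtHom : (grCosimplicial k (GDisc C)).Hom (grCosimplicial k (G C)) where
  app n := Gr.zeroExt k (acyclic_gCat n)
  comm n i a := Gr.pull_zeroExt_comm k (acyclic_gCat (n + 1)) (acyclic_gCat n) (gFace C n i)
    (fun _ _ f hf => isIdentity_of_gFace i f hf) a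

theorem iotaStar_zeroExtHom (n : ℕ) (a : GDiscH k C n) :
    iotaStar k C n ((zeroExtHom k C).mapH n a) = a := by
  obtain ⟨z, rfl⟩ := QuotientAddGroup.mk_surjective a
  exact congrArg QuotientAddGroup.mk (Subtype.ext (Gr.pull_zeroExt k (acyclic_gCat n) z.1))

theorem iotaStar_surjective (n : ℕ) : Function.Surjective (iotaStar k C n) :=
  fun a => ⟨_, iotaStar_zeroExtHom k C n a⟩

/-- Restriction and extension by zero are already mutually inverse on Gr in degree n. Degree n - 1
may still contain non-identities, but this is harmless because both maps are morphisms of complexes.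
-/
theorem iotaStar_injective [Finite C] {N : ℕ} (hN : IsCompositionLength C N) {n : ℕ}
    (hn : N < 2 * n) : Function.Injective (iotaStar k C n) := by
  refine Function.LeftInverse.injective (g := (zeroExtHom k C).mapH n) fun a => ?_
  obtain ⟨z, rfl⟩ := QuotientAddGroup.mk_surjective a
  exact congrArg QuotientAddGroup.mk (Subtype.ext (Gr.zeroExt_pull k (acyclic_gCat n)
    (fun _ _ f => isIdentity_of_lt hN hn f) z.1))

/-- The restriction of integral cochains on the nerve to the non-degenerate simplices. -/
def restrictCochains : (cochains (nerve C)).Hom (grCosimplicial k (GDisc C)) where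
  app n := (Gr.dimEquiv k (GCat C n)).symm.toAddMonoidHom.comp
    (AddMonoidHom.pi fun x : GCat C n => Pi.evalAddMonoidHom (fun _ => ℤ) x.obj.obj)
  comm n i a := (Gr.dimEquiv k (GCat C (n + 1))).injective <| funext fun x => by
    refine (congrFun (AddEquiv.apply_symm_apply _ _) x).trans ?_
    refine Eq.symm ((Gr.dimEquiv_apply k _ _ x).trans ((Gr.dim_pull k _ _ _).trans ?_))
    exact congrFun (AddEquiv.apply_symm_apply (Gr.dimEquiv k (GCat C n)) _) _

theorem dim_restrictCochains (n : ℕ) (c : (cochains (nerve C)).obj n) (x : GCat C n) :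
    Gr.dim k (Discrete.mk x) ((restrictCochains k C).app n c) = c x.obj.obj :=
  congrFun (AddEquiv.apply_symm_apply (Gr.dimEquiv k (GCat C n)) _) x

variable {C} in
theorem gDisc_ext {n : ℕ} {a b : (grCosimplicial k (GDisc C)).obj n}
    (h : ∀ x : GCat C n, Gr.dim k (Discrete.mk x) a = Gr.dim k (Discrete.mk x) b) : a = b :=
  (Gr.dimEquiv k (GCat C n)).injective (funext h)

open Classical in
/-- The extension by zero of a function on the non-degenerate simplices. -/
def extendCochain (n : ℕ) (a : (grCosimplicial k (GDisc C)).obj n) :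
    (cochains (nerve C)).obj n := fun x =>
  if hx : isNonDegenerate C n x then Gr.dim k (Discrete.mk (⟨⟨x, hx⟩⟩ : GCat C n)) a else 0

theorem extendCochain_of_degenerate {n : ℕ} (a : (grCosimplicial k (GDisc C)).obj n)
    {x : ComposableArrows C n} (hx : ¬ isNonDegenerate C n x) : extendCochain k C n a x = 0 :=
  dif_neg hx

theorem restrictCochains_extendCochain {n : ℕ} (a : (grCosimplicial k (GDisc C)).obj n) :
    (restrictCochains k C).app n (extendCochain k C n a) = a :=
  gDisc_ext k fun x => (dim_restrictCochains k C n _ x).trans (dif_pos x.obj.property)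

/-- Non-degenerate simplices see only the restricted cochain; on degenerate ones the coboundary of a
normalized cochain vanishes. -/
theorem d_extendCochain {n : ℕ} {a : (grCosimplicial k (GDisc C)).obj n}
    (ha : (grCosimplicial k (GDisc C)).d n a = 0) :
    (cochains (nerve C)).d n (extendCochain k C n a) = 0 := by
  funext x
  by_cases hx : isNonDegenerate C (n + 1) x
  · refine (dim_restrictCochains k C (n + 1) _ ⟨⟨x, hx⟩⟩).symm.trans ?_
    rw [SemiCosimplicialAb.Hom.comm_d, restrictCochains_extendCochain, ha]
    exact map_zero (Gr.dim k _)
  · exact cochains_d_eq_zero_of_degenerate n _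
      (fun y hy => extendCochain_of_degenerate k C a (not_not.2 hy)) (not_not.1 hx)

theorem restrictCochains_mapH_bijective (n : ℕ) :
    Function.Bijective ((restrictCochains k C).mapH n) := by
  constructor
  · refine (injective_iff_map_eq_zero _).2 fun a ha => ?_
    obtain ⟨c, rfl⟩ := QuotientAddGroup.mk_surjective a
    replace ha : (restrictCochains k C).app n c.1 ∈
        (grCosimplicial k (GDisc C)).coboundaries n :=
      (QuotientAddGroup.eq_zero_iff ((restrictCochains k C).mapCocycles n c)).1 ha
    refine (QuotientAddGroup.eq_zero_iff c).2 ?_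
    change c.1 ∈ (cochains (nerve C)).coboundaries n
    -- A primitive of the restriction is extended by zero; subtracting its coboundary b leaves a
    -- cocycle that vanishes on all non-degenerate simplices.
    obtain ⟨b, hb, hbc⟩ : ∃ b ∈ (cochains (nerve C)).coboundaries n,
        (restrictCochains k C).app n b = (restrictCochains k C).app n c.1 := by
      cases n with
      | zero =>
        have h0 : (restrictCochains k C).app 0 c.1 = 0 := ha
        exact ⟨0, zero_mem _, by rw [h0, map_zero]⟩
      | succ n =>
        obtain ⟨a, ha⟩ := ha
        refine ⟨_, ⟨extendCochain k C n a, rfl⟩, ?_⟩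
        rw [SemiCosimplicialAb.Hom.comm_d, restrictCochains_extendCochain, ha]
    have h := mem_coboundaries_of_vanish (X := nerve C)
      (fun n i x hx => isNonDegenerate_face i hx) n (c.1 - b)
      (sub_mem c.2 ((cochains (nerve C)).coboundaries_le_cocycles n hb)) fun x hx => by
        refine (dim_restrictCochains k C n _ ⟨⟨x, hx⟩⟩).symm.trans ?_
        rw [map_sub, hbc, sub_self]
        exact map_zero (Gr.dim k _)
    simpa using add_mem h hb
  · intro a
    obtain ⟨z, rfl⟩ := QuotientAddGroup.mk_surjective a
    exact ⟨SemiCosimplicialAb.cls _ ⟨extendCochain k C n z.1, d_extendCochain k C z.2⟩,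
      congrArg QuotientAddGroup.mk (Subtype.ext (restrictCochains_extendCochain k C z.1))⟩

/-- The cohomology of `Gr(kG^∅_•)` is the integral cohomology of the nerve. -/
def gDiscHEquiv (n : ℕ) : GDiscH k C n ≃+ integralCohomology (nerve C) n :=
  (AddEquiv.ofBijective _ (restrictCochains_mapH_bijective k C n)).symm

/-- Dimensions determine elements of Gr in the discrete case, so z is exactly the restriction of c;
the values of c on degenerate simplices play no role. -/
theorem gDiscHEquiv_cls (n : ℕ) (z : (grCosimplicial k (GDisc C)).cocycles n)
    (c : (cochains (nerve C)).cocycles n)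
    (h : ∀ x : GCat C n, Gr.dim k (Discrete.mk x) z.1 = c.1 x.obj.obj) :
    gDiscHEquiv k C n (SemiCosimplicialAb.cls _ z) = SemiCosimplicialAb.cls _ c := by
  refine (AddEquiv.symm_apply_eq _).2 (congrArg QuotientAddGroup.mk (Subtype.ext ?_))
  exact gDisc_ext k fun x => (h x).trans (dim_restrictCochains k C n c.1 x).symm

end Comparison

theorem SemiCosimplicialAb.subsingleton_H (A : SemiCosimplicialAb.{u}) (n : ℕ)
    [Subsingleton (A.obj n)] : Subsingleton (A.H n) :=
  QuotientAddGroup.mk_surjective.subsingleton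

end RepCoh

end

theorem mainTheorem7 (k : Type w) [Field k] (C : Type u) [CategoryTheory.Category.{v} C]
    [Finite C] [∀ x y : C, Finite (x ⟶ y)] [RepCoh.IsDirect C]
    (N : ℕ) (hN : 0 < N) (hlen : RepCoh.IsCompositionLength C N) :
    (∀ n : ℕ, N < n → Subsingleton (RepCoh.EH k C n) ∧ Subsingleton (RepCoh.GH k C n)) ∧
    ∃ θ : ∀ n : ℕ, RepCoh.GDiscH k C n ≃+ RepCoh.integralCohomology (CategoryTheory.nerve C) n,
      (∀ (n : ℕ) (z : (RepCoh.grCosimplicial k (RepCoh.GDisc C)).cocycles n)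
        (c : (RepCoh.cochains (CategoryTheory.nerve C)).cocycles n),
        (∀ x : RepCoh.GCat C n,
          RepCoh.Gr.dim k (CategoryTheory.Discrete.mk x) z.1 = c.1 x.obj.obj) →
        θ n (RepCoh.SemiCosimplicialAb.cls _ z) = RepCoh.SemiCosimplicialAb.cls _ c) ∧
      (∀ n : ℕ, N / 2 + 1 ≤ n →
        Function.Bijective fun a : RepCoh.GH k C n => θ n (RepCoh.iotaStar k C n a)) ∧
      (∀ n : ℕ, 1 ≤ n → n ≤ N / 2 →
        Function.Surjective fun a : RepCoh.GH k C n => θ n (RepCoh.iotaStar k C n a)) := by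
  refine ⟨fun n hn => ?_, RepCoh.gDiscHEquiv k C, RepCoh.gDiscHEquiv_cls k C, fun n hn => ?_,
    fun n _ _ => ?_⟩
  · have hE : IsEmpty (RepCoh.ECat C n) :=
      ⟨fun x => (RepCoh.le_of_isNonDegenerate hlen x.property).not_gt hn⟩
    have hG : IsEmpty (RepCoh.GCat C n) := ⟨fun x => hE.false x.obj⟩
    have h1 : Subsingleton ((RepCoh.grCosimplicial k (RepCoh.E C)).obj n) :=
      RepCoh.Gr.subsingleton_of_isEmpty k (RepCoh.ECat C n)
    have h2 : Subsingleton ((RepCoh.grCosimplicial k (RepCoh.G C)).obj n) :=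
      RepCoh.Gr.subsingleton_of_isEmpty k (RepCoh.GCat C n)
    exact ⟨RepCoh.SemiCosimplicialAb.subsingleton_H _ n, RepCoh.SemiCosimplicialAb.subsingleton_H _ n⟩
  · exact (RepCoh.gDiscHEquiv k C n).bijective.comp
      -- ⌊N/2⌋ + 1 ≤ n is the condition N < 2n; only injectivity uses it.
      ⟨RepCoh.iotaStar_injective k C hlen (by omega), RepCoh.iotaStar_surjective k C n⟩
  · exact (RepCoh.gDiscHEquiv k C n).surjective.comp (RepCoh.iotaStar_surjective k C n)
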